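/- Let $q$ be an indeterminate. For $\sigma\in\mathfrak{S}_n$, a right-to-left maximum is an index $i$ such that $\sigma(i)>\sigma(j)$ for all $i<j\le n$, and a special inversion is a pair $(i,j)$ with $1\le i<j\le n$ and $\sigma(i)>\sigma(j)$ such that $\sigma(i)<\sigma(m)$ for some $m$ with $j<m\le n$. Let $S_1[n,k]=\sum_{\sigma} q^{\mathrm{inv}'(\sigma)}$, where $\sigma$ runs over the permutations in $\mathfrak{S}_n$ having exactly $k$ right-to-left maxima and $\mathrm{inv}'(\sigma)$ is the number of special inversions of $\sigma$. Let $$B^{n,k}_{i,j}=\binom{n+j-1}{k-1}\binom{n-i-1}{k-1}-\binom{n+j}{k-1}\binom{n-i-2}{k-1},$$ where $\binom uv$ is the usual binomial coefficient for $0\le v\le u$, $\binom uu=1$ also for $u<0$, and $\binom uv=0$ in all other cases. Let $\genfrac[]{0pt}{}{i}{j}_q=\frac{[i]_q!}{[j]_q!\,[i-j]_q!}$ for $0\le j\le i$ denote the $q$-binomial coefficient, where $[m]_q!=\prod_{l=1}^m(1+q+\dots+q^{l-1})$. Theorem. For all integers $0\le k\le n$, the following identity holds in $\mathbb{Z}[q]$: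 $$(1-q)^{n-k}\,S_1[n,k]=\sum_{j=0}^{n-k}\ \sum_{i=j}^{n-k}(-1)^j\,B^{n+1,k+1}_{i,j}\;q^{\,i+\binom j2}\genfrac[]{0pt}{}{i}{j}_q .$$ -/

import Mathlib

open Polynomial

namespace QStirling

/-- The `q`-integer `[i]_q = 1 + q + ⋯ + q^(i-1)`; the indeterminate `q` is `X : ℤ[X]`. -/
noncomputable def qInt (i : ℕ) : ℤ[X] := ∑ l ∈ Finset.range i, X ^ l

/-- The `q`-factorial `[n]_q! = [1]_q [2]_q ⋯ [n]_q`. -/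
noncomputable def qFactorial (n : ℕ) : ℤ[X] := ∏ i ∈ Finset.range n, qInt (i + 1)

/-- The `q`-binomial coefficient `[n]_q! / ([k]_q! [n-k]_q!)`, and `0` if `k > n`.
The divisor is monic and the division is exact, see `qBinom_mul`. -/
noncomputable def qBinom (n k : ℕ) : ℤ[X] :=
  if k ≤ n then qFactorial n /ₘ (qFactorial k * qFactorial (n - k)) else 0

theorem qInt_succ_monic (i : ℕ) : (qInt (i + 1)).Monic :=
  Polynomial.Monic.geom_sum' (R := ℤ) monic_X (by simp) (Nat.succ_ne_zero i)

theorem qFactorial_monic (n : ℕ) : (qFactorial n).Monic :=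
  monic_prod_of_monic _ _ fun i _ => qInt_succ_monic i

theorem qFactorial_succ (n : ℕ) : qFactorial (n + 1) = qFactorial n * qInt (n + 1) :=
  Finset.prod_range_succ _ _

theorem qInt_add (a b : ℕ) : qInt (a + b) = qInt a + X ^ a * qInt b := by
  simp only [qInt, Finset.sum_range_add, Finset.mul_sum, pow_add]

theorem qFactorial_mul_dvd (a b : ℕ) :
    qFactorial a * qFactorial b ∣ qFactorial (a + b) := by
  induction a generalizing b with
  | zero => simp [qFactorial]
  | succ a iha =>
    induction b with
    | zero => simp [qFactorial]
    | succ b ihb =>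
      obtain ⟨c, hc⟩ := iha (b + 1)
      obtain ⟨d, hd⟩ := ihb
      refine ⟨c + X ^ (a + 1) * d, ?_⟩
      have h1 : a + 1 + (b + 1) = (a + 1 + b) + 1 := by ring
      have h2 : a + (b + 1) = a + 1 + b := by ring
      rw [h2] at hc
      rw [h1, qFactorial_succ, ← h1, qInt_add, mul_add, hc, ← hc, hd]
      nth_rewrite 1 [← hd]
      rw [hc, qFactorial_succ a, qFactorial_succ b]
      ring

/-- The division defining the `q`-binomial coefficient is exact. -/
theorem qBinom_mul {n k : ℕ} (h : k ≤ n) :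
    qBinom n k * (qFactorial k * qFactorial (n - k)) = qFactorial n := by
  have hm : (qFactorial k * qFactorial (n - k)).Monic :=
    (qFactorial_monic k).mul (qFactorial_monic _)
  have hd : qFactorial k * qFactorial (n - k) ∣ qFactorial n := by
    have := qFactorial_mul_dvd k (n - k)
    rwa [Nat.add_sub_cancel' h] at this
  rw [qBinom, if_pos h, mul_comm]
  have h0 := (modByMonic_eq_zero_iff_dvd hm).2 hd
  have h1 := modByMonic_add_div (qFactorial n) (qFactorial k * qFactorial (n - k))
  rwa [h0, zero_add] at h1

/-- `i` is a right-to-left maximum of `σ`: `σ i > σ j` for all `j > i`. -/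
def IsRLMax {n : ℕ} (σ : Equiv.Perm (Fin n)) (i : Fin n) : Prop :=
  ∀ j : Fin n, i < j → σ j < σ i

/-- `(i, j)` is a special inversion of `σ`: an inversion such that some later value `σ k`,
with `k > j`, exceeds `σ i`. -/
def IsSpecialInv {n : ℕ} (σ : Equiv.Perm (Fin n)) (i j : Fin n) : Prop :=
  i < j ∧ σ j < σ i ∧ ∃ k : Fin n, j < k ∧ σ i < σ k

open Classical in
/-- The number of right-to-left maxima of `σ`. -/
noncomputable def rlm {n : ℕ} (σ : Equiv.Perm (Fin n)) : ℕ :=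
  (Finset.univ.filter fun i : Fin n => IsRLMax σ i).card

open Classical in
/-- The number of special inversions of `σ`. -/
noncomputable def specialInv {n : ℕ} (σ : Equiv.Perm (Fin n)) : ℕ :=
  (Finset.univ.filter fun p : Fin n × Fin n => IsSpecialInv σ p.1 p.2).card

/-- The `q`-Stirling number of the first kind `S₁[n,k]`: the sum of `q^(inv' σ)` over the
permutations `σ` of `n` letters with `k` right-to-left maxima. -/
noncomputable def qStirling₁ (n k : ℕ) : ℤ[X] :=
  ∑ σ ∈ Finset.univ.filter (fun σ : Equiv.Perm (Fin n) => rlm σ = k), X ^ specialInv σ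

/-- Binomial coefficients with integer arguments: the usual ones if `0 ≤ v ≤ u`, with the
conventions `binom u u = 1` also for negative `u` (so `binom (-1) (-1) = binom (-2) (-2) = 1`)
and `binom u v = 0` in all other cases. -/
def binom (u v : ℤ) : ℤ :=
  if 0 ≤ v ∧ v ≤ u then (u.toNat.choose v.toNat : ℤ) else if u = v then 1 else 0

/-- The integers `B^{n,k}_{i,j}`. -/
def B (n k i j : ℕ) : ℤ :=
  binom (n + j - 1) (k - 1) * binom (n - i - 1) (k - 1)
    - binom (n + j) (k - 1) * binom (n - i - 2) (k - 1)

end QStirling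

/-!
The permutations are generated by inserting a new smallest value at an arbitrary position. Let `c_p`
be the number of entries before position `p` that are exceeded by some entry at position `p` or
later. Inserting a smallest value at position `p` creates exactly `c_p` special inversions, it
creates a right-to-left maximum exactly if it takes place at the end, and it changes
`(c_0, …, c_(n-1))` into `(c_0, …, c_p, c_p + 1, …, c_(n-1) + 1)`. Weight a permutation by the
product of the series `1 / (1 - q^(c_p) z)`. A telescoping sum (`prod_geomSeries_sub`) shows that the
insertions before the end act on this weight together as the `q`-derivative
`D f = (f(z) - f(q z)) / ((1 - q) z)`, and the insertion at the end acts as multiplication by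
`1 / (1 - z)`. Hence `S₁[n,k]` is the constant coefficient in `z` of the coefficient of `aᵏ` in
`(D + a / (1 - z))ⁿ 1`; this is `stirlingSeries_succ`.

After rescaling by powers of `1 - q`, the generating function `G = ∑ tⁿ Gₙ` of the series
`Gₙ(z) = ((1 - q) D + a / (1 - z))ⁿ 1` is determined by
`G = 1 + t ((G(z) - G(q z)) / z + a G(z) / (1 - z))`. The kernel of this equation is a quadratic
polynomial in `z`; let `u = t + ⋯` and `1 / w = 1 + ⋯` be its roots, so that `u = t w` and
`w = 1 + t (w² + (a - 1) w)`. The solution is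
`G = (1 - z) ∑ i, (q u)^i w (w; q)_i / (z w; q)_(i+1)`,
which satisfies the equation term by term, by Pascal's rule for the expansion of
`1 / (z w; q)_(i+1)` and by `(w; q)_(i+1) = (w; q)_i (1 - q^i w)`. At `z = 0`, the `q`-binomial
theorem gives `∑ i, ∑ j, (-1)^j q^(i + j (j - 1) / 2) [i, j]_q u^i w^(j+1)`, and the coefficient of
`tⁿ aᵏ` in `u^i w^(j+1) = t^i w^(i+j+1)` is `B^(n+1,k+1)_(i,j)`.

The series `w` is handled through the closed form `wCoeff` of the coefficients of its powers and the
linear map `wEval`, which extracts a coefficient of `p(w)` from a polynomial `p`; the quadratic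
equation becomes `wEval_X_mul`.
-/

namespace QStirling

/-! ### Gaussian binomial coefficients -/

theorem qFactorial_ne_zero (n : ℕ) : qFactorial n ≠ 0 := (qFactorial_monic n).ne_zero

theorem qBinom_add_mul (i m : ℕ) :
    qBinom (i + m) m * (qFactorial m * qFactorial i) = qFactorial (i + m) := by
  have h := qBinom_mul (Nat.le_add_left m i)
  rwa [Nat.add_sub_cancel] at h

theorem qBinom_eq_zero {n k : ℕ} (h : n < k) : qBinom n k = 0 := if_neg (by omega)

theorem qBinom_zero_right (n : ℕ) : qBinom n 0 = 1 := by
  have h := qBinom_add_mul n 0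
  have h0 : qFactorial 0 = 1 := by simp [qFactorial]
  rw [h0, one_mul, add_zero] at h
  exact mul_right_cancel₀ (qFactorial_ne_zero n) (by rw [h, one_mul])

theorem qBinom_self (n : ℕ) : qBinom n n = 1 := by
  have h := qBinom_add_mul 0 n
  have h0 : qFactorial 0 = 1 := by simp [qFactorial]
  rw [h0, mul_one, zero_add] at h
  exact mul_right_cancel₀ (qFactorial_ne_zero n) (by rw [h, one_mul])

theorem one_sub_mul_qInt (n : ℕ) : (1 - X) * qInt n = 1 - X ^ n :=
  mul_neg_geom_sum X n

theorem qBinom_pascal (i m : ℕ) :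
    qBinom (i + 1 + (m + 1)) (m + 1)
      = qBinom (i + 1 + m) m + X ^ (m + 1) * qBinom (i + (m + 1)) (m + 1) := by
  have hne : qFactorial (m + 1) * qFactorial (i + 1) ≠ 0 :=
    mul_ne_zero (qFactorial_ne_zero _) (qFactorial_ne_zero _)
  apply mul_right_cancel₀ hne
  have h1 := qBinom_add_mul (i + 1) m
  have h2 := qBinom_add_mul i (m + 1)
  have e1 : i + 1 + (m + 1) = i + 1 + m + 1 := rfl
  have e2 : i + (m + 1) = i + 1 + m := by ring
  have h3 : qInt (i + 1 + m + 1) = qInt (m + 1) + X ^ (m + 1) * qInt (i + 1) := by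
    rw [← qInt_add]; congr 1; ring
  rw [qBinom_add_mul, e1, qFactorial_succ, h3, mul_add, add_mul]
  congr 1
  · rw [← h1, qFactorial_succ m]; ring
  · rw [← e2, ← h2, qFactorial_succ i]; ring

/-- The other Pascal rule, the one that multiplies the lower-index term by a power of `q`. -/
theorem qBinom_pascal' (i m : ℕ) :
    qBinom (i + (m + 1) + 1) (m + 1)
      = qBinom (i + (m + 1)) (m + 1) + X ^ (i + 1) * qBinom (i + (m + 1)) m := by
  have hne : qFactorial (m + 1) * qFactorial (i + 1) ≠ 0 :=
    mul_ne_zero (qFactorial_ne_zero _) (qFactorial_ne_zero _)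
  apply mul_right_cancel₀ hne
  have h1 := qBinom_add_mul (i + 1) m
  have h2 := qBinom_add_mul i (m + 1)
  have h0 := qBinom_add_mul (i + 1) (m + 1)
  have e1 : i + 1 + (m + 1) = i + (m + 1) + 1 := by ring
  have e2 : i + 1 + m = i + (m + 1) := by ring
  rw [e1] at h0
  rw [e2] at h1
  have h3 : qInt (i + (m + 1) + 1) = qInt (i + 1) + X ^ (i + 1) * qInt (m + 1) := by
    rw [← qInt_add]; congr 1; ring
  rw [h0, qFactorial_succ, h3, mul_add, add_mul]
  congr 1
  · rw [← h2, qFactorial_succ i]; ring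
  · rw [← h1, qFactorial_succ m]; ring

theorem qBinom_absorb (i m : ℕ) :
    (1 - X ^ (m + 1)) * qBinom (i + (m + 1)) (m + 1)
      = (1 - X ^ (i + m + 1)) * qBinom (i + m) m := by
  have hne : qFactorial m * qFactorial i ≠ 0 :=
    mul_ne_zero (qFactorial_ne_zero _) (qFactorial_ne_zero _)
  apply mul_right_cancel₀ hne
  have h2 := qBinom_add_mul i (m + 1)
  have e : i + (m + 1) = i + m + 1 := rfl
  rw [e, qFactorial_succ, qFactorial_succ, ← qBinom_add_mul i m] at h2
  rw [← one_sub_mul_qInt, ← one_sub_mul_qInt, e]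
  linear_combination (1 - X) * h2

/-- The `q`-Pochhammer symbol `(W; q)_i = (1 - W)(1 - qW) ⋯ (1 - q^(i-1) W)`, as a polynomial in
a new variable `W` over `ℤ[q]`. -/
noncomputable def qPoch (i : ℕ) : ℤ[X][X] :=
  ∏ l ∈ Finset.range i, (1 - C (X ^ l) * X)

theorem qPoch_succ (i : ℕ) : qPoch (i + 1) = qPoch i * (1 - C (X ^ i) * X) :=
  Finset.prod_range_succ _ _

/-- The `q`-binomial theorem, coefficient by coefficient. -/
theorem coeff_qPoch (i j : ℕ) :
    (qPoch i).coeff j = (-1) ^ j * X ^ j.choose 2 * qBinom i j := by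
  induction i generalizing j with
  | zero =>
    cases j with
    | zero => simp [qPoch, qBinom_zero_right]
    | succ j => simp [qPoch, qBinom_eq_zero, coeff_one]
  | succ i ih =>
    rw [qPoch_succ, mul_sub, mul_one, coeff_sub, mul_left_comm, coeff_C_mul, ih]
    cases j with
    | zero => simp [qBinom_zero_right]
    | succ j =>
      rw [coeff_mul_X, ih, Nat.choose_succ_succ' j 1, Nat.choose_one_right]
      rcases lt_trichotomy i j with h | h | h
      · simp [qBinom_eq_zero h, qBinom_eq_zero (show i < j + 1 by omega),
          qBinom_eq_zero (show i + 1 < j + 1 by omega)]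
      · subst h
        rw [qBinom_self, qBinom_self, qBinom_eq_zero (Nat.lt_succ_self i)]
        ring
      · obtain ⟨d, rfl⟩ : ∃ d, i = d + (j + 1) := ⟨i - (j + 1), by omega⟩
        rw [qBinom_pascal']
        ring

/-! ### The powers of the algebraic series `w` -/

/-- The number `[tⁿ aᵏ] w ^ r`, where `w = w(t)` is the power series over `ℤ[a]` with
`w = 1 + t (w² + (a - 1) w)`. The series itself is not needed: it enters only through the
recurrences `wCoeff_rec_zero` and `wCoeff_rec_succ`. The degree `n = 0` is separate, as
`w ^ r` has constant term `1` for `r = 0` too. -/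
def wCoeff (n r k : ℕ) : ℤ :=
  match n with
  | 0 => if k = 0 then 1 else 0
  | n + 1 => (n + r).choose k * (n + 1).choose k - (n + 1 + r).choose k * n.choose k

theorem wCoeff_succ_zero_left (n k : ℕ) : wCoeff (n + 1) 0 k = 0 := by
  simp [wCoeff, mul_comm]

/-- The equation `w^(r+1) = w^r + t (w^(r+2) - w^(r+1) + a w^(r+1))`, in positive degree in `a`. -/
theorem wCoeff_rec_succ (n r k : ℕ) :
    wCoeff (n + 1) (r + 1) (k + 1) = wCoeff (n + 1) r (k + 1) + wCoeff n (r + 2) (k + 1)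
      - wCoeff n (r + 1) (k + 1) + wCoeff n (r + 1) k := by
  cases n with
  | zero =>
    cases k with
    | zero => simp [wCoeff]
    | succ k => simp [wCoeff, Nat.choose_eq_zero_of_lt (show 1 < k + 1 + 1 by omega)]
  | succ n =>
    have e1 : n + 1 + (r + 1) = n + 1 + r + 1 := rfl
    have e2 : n + 1 + 1 + (r + 1) = n + 1 + r + 1 + 1 := by ring
    have e3 : n + 1 + 1 + r = n + 1 + r + 1 := by ring
    have e4 : n + (r + 2) = n + 1 + r + 1 := by ring
    have e5 : n + 1 + (r + 2) = n + 1 + r + 1 + 1 := by ring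
    have e6 : n + (r + 1) = n + 1 + r := by ring
    simp only [wCoeff, e1, e2, e3, e4, e5, e6]
    rw [Nat.choose_succ_succ' (n + 1 + r + 1) k, Nat.choose_succ_succ' (n + 1 + r) k,
      Nat.choose_succ_succ' (n + 1) k, Nat.choose_succ_succ' n k]
    push_cast
    ring

theorem wCoeff_rec_zero (n r : ℕ) :
    wCoeff (n + 1) (r + 1) 0 = wCoeff (n + 1) r 0 + wCoeff n (r + 2) 0 - wCoeff n (r + 1) 0 := by
  cases n <;> simp [wCoeff]

theorem wCoeff_eq_zero {n r k : ℕ} (h : n < k) : wCoeff n r k = 0 := by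
  cases n with
  | zero => simp [wCoeff]; omega
  | succ n => simp [wCoeff, Nat.choose_eq_zero_of_lt h,
      Nat.choose_eq_zero_of_lt (show n < k by omega)]

theorem binom_natCast (u v : ℕ) : binom u v = u.choose v := by
  unfold binom
  by_cases h : v ≤ u
  · simp [h]
  · rw [if_neg (by omega), if_neg (by omega), Nat.choose_eq_zero_of_lt (by omega)]
    simp

theorem B_eq_wCoeff {n i : ℕ} (j k : ℕ) (hi : i ≤ n) :
    B (n + 1) (k + 1) i j = wCoeff (n - i) (i + j + 1) k := by
  obtain ⟨N, rfl⟩ := Nat.exists_eq_add_of_le hi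
  rw [Nat.add_sub_cancel_left]
  have h1 : (((i + N + 1 : ℕ) : ℤ) + j - 1) = ((N + i + j : ℕ) : ℤ) := by push_cast; ring
  have h2 : (((i + N + 1 : ℕ) : ℤ) - i - 1) = (N : ℕ) := by push_cast; ring
  have h3 : (((i + N + 1 : ℕ) : ℤ) + j) = ((N + i + j + 1 : ℕ) : ℤ) := by push_cast; ring
  have h4 : (((k + 1 : ℕ) : ℤ) - 1) = (k : ℕ) := by push_cast; ring
  have h5 : (((i + N + 1 : ℕ) : ℤ) - i - 2) = (N : ℤ) - 1 := by push_cast; ring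
  rw [B, h1, h2, h3, h4, h5, binom_natCast, binom_natCast, binom_natCast]
  cases N with
  | zero =>
    -- here `binom (-1) k = 0`, because `k ≥ 0`
    have : binom (((0 : ℕ) : ℤ) - 1) k = 0 := by
      unfold binom
      rw [if_neg (by omega), if_neg (by omega)]
    rw [this]
    cases k <;> simp [wCoeff]
  | succ N =>
    have h6 : ((N + 1 : ℕ) : ℤ) - 1 = (N : ℕ) := by push_cast; ring
    rw [h6, binom_natCast, wCoeff]
    have e1 : N + (i + j + 1) = N + 1 + i + j := by ring
    have e2 : N + 1 + (i + j + 1) = N + 1 + i + j + 1 := by ring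
    rw [e1, e2]

/-- Extraction of the coefficient of `tⁿ aᵏ` after the substitution `W = w(t)`: the
`ℤ[q]`-linear map with `W ^ r ↦ [tⁿ aᵏ] w ^ r`. -/
noncomputable def wEval (n k : ℕ) : ℤ[X][X] →ₗ[ℤ[X]] ℤ[X] :=
  Polynomial.lsum fun r => (C (wCoeff n r k) : ℤ[X]) • LinearMap.id

theorem wEval_monomial (n k r : ℕ) (c : ℤ[X]) :
    wEval n k (monomial r c) = C (wCoeff n r k) * c := by
  rw [wEval, lsum_apply, sum_monomial_index _ _ (by simp)]
  simp

theorem wEval_X_pow (n k r : ℕ) : wEval n k (X ^ r) = C (wCoeff n r k) := by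
  rw [X_pow_eq_monomial, wEval_monomial, mul_one]

theorem wEval_C_mul (n k : ℕ) (c : ℤ[X]) (p : ℤ[X][X]) :
    wEval n k (C c * p) = c * wEval n k p := by
  rw [C_mul', map_smul, smul_eq_mul]

theorem wEval_X_mul_succ_succ (n k : ℕ) (p : ℤ[X][X]) :
    wEval (n + 1) (k + 1) (X * p) = wEval (n + 1) (k + 1) p + wEval n (k + 1) (X ^ 2 * p)
      - wEval n (k + 1) (X * p) + wEval n k (X * p) := by
  induction p using Polynomial.induction_on' with
  | add p r hp hr => simp only [mul_add, map_add, hp, hr]; ring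
  | monomial r c =>
    rw [X_mul_monomial, X_pow_mul_monomial]
    simp only [wEval_monomial, wCoeff_rec_succ, map_add, map_sub]
    ring

theorem wEval_X_mul_succ_zero (n : ℕ) (p : ℤ[X][X]) :
    wEval (n + 1) 0 (X * p) = wEval (n + 1) 0 p + wEval n 0 (X ^ 2 * p)
      - wEval n 0 (X * p) := by
  induction p using Polynomial.induction_on' with
  | add p r hp hr => simp only [mul_add, map_add, hp, hr]; ring
  | monomial r c =>
    rw [X_mul_monomial, X_pow_mul_monomial]
    simp only [wEval_monomial, wCoeff_rec_zero, map_add, map_sub]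
    ring

theorem wEval_zero_X_mul (k : ℕ) (p : ℤ[X][X]) : wEval 0 k (X * p) = wEval 0 k p := by
  induction p using Polynomial.induction_on' with
  | add p r hp hr => simp only [mul_add, map_add, hp, hr]
  | monomial r c => rw [X_mul_monomial, wEval_monomial, wEval_monomial]; rfl

/-- The effect on the coefficient sequence `f` of multiplying a power series in `a` by `a`. -/
def prevDeg {M : Type*} [Zero M] (f : ℕ → M) : ℕ → M
  | 0 => 0
  | k + 1 => f k

/-- `w p(w) = p(w) + t (w² p(w) - w p(w) + a w p(w))`, at the coefficient of `tⁿ⁺¹ aᵏ`. -/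
theorem wEval_X_mul (n k : ℕ) (p : ℤ[X][X]) :
    wEval (n + 1) k (X * p) = wEval (n + 1) k p + wEval n k (X ^ 2 * p)
      - wEval n k (X * p) + prevDeg (fun l => wEval n l (X * p)) k := by
  cases k with
  | zero => rw [wEval_X_mul_succ_zero, prevDeg, add_zero]
  | succ k => exact wEval_X_mul_succ_succ n k p

/-! ### The explicit solution of the `q`-difference equation -/

/-- The coefficient of `tⁿ aᵏ zᵐ` in
`∑ i, (q u)^i w (w; q)_i / (z w; q)_(i+1)`, where `u = t w`. -/
noncomputable def solCoeff (n k m : ℕ) : ℤ[X] :=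
  ∑ i ∈ Finset.range (n + 1),
    X ^ i * qBinom (i + m) m * wEval (n - i) k (X * (X ^ (i + m) * qPoch i))

theorem solCoeff_zero (k m : ℕ) : solCoeff 0 k m = if k = 0 then 1 else 0 := by
  have : (X * (X ^ (0 + m) * qPoch 0) : ℤ[X][X]) = X ^ (m + 1) := by simp [qPoch, pow_succ']
  rw [solCoeff, Finset.sum_range_one, this, wEval_X_pow, zero_add, qBinom_self]
  by_cases hk : k = 0 <;> simp [wCoeff, hk]

theorem prevDeg_sum {ι : Type*} (s : Finset ι) (c : ι → ℤ[X]) (f : ι → ℕ → ℤ[X]) (k : ℕ) :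
    prevDeg (fun l => ∑ i ∈ s, c i * f i l) k = ∑ i ∈ s, c i * prevDeg (f i) k := by
  cases k <;> simp [prevDeg]

/-- The relation `wEval_X_mul`, summed over `i`. The term `i = n + 1` only involves `wEval 0`, which
does not see the factor `W`. -/
theorem solCoeff_succ (n k m : ℕ) :
    solCoeff (n + 1) k m =
      ∑ i ∈ Finset.range (n + 2),
        X ^ i * qBinom (i + m) m * wEval (n + 1 - i) k (X ^ (i + m) * qPoch i)
      + ∑ i ∈ Finset.range (n + 1), X ^ i * qBinom (i + m) m *
        (wEval (n - i) k (X ^ 2 * (X ^ (i + m) * qPoch i))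
          - wEval (n - i) k (X * (X ^ (i + m) * qPoch i)))
      + prevDeg (fun l => solCoeff n l m) k := by
  simp only [solCoeff]
  have key : ∑ i ∈ Finset.range (n + 1),
        X ^ i * qBinom (i + m) m * wEval (n + 1 - i) k (X * (X ^ (i + m) * qPoch i))
      = ∑ i ∈ Finset.range (n + 1),
          X ^ i * qBinom (i + m) m * wEval (n + 1 - i) k (X ^ (i + m) * qPoch i)
        + ∑ i ∈ Finset.range (n + 1), X ^ i * qBinom (i + m) m *
          (wEval (n - i) k (X ^ 2 * (X ^ (i + m) * qPoch i))
            - wEval (n - i) k (X * (X ^ (i + m) * qPoch i)))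
        + ∑ i ∈ Finset.range (n + 1), X ^ i * qBinom (i + m) m *
          prevDeg (fun l => wEval (n - i) l (X * (X ^ (i + m) * qPoch i))) k := by
    rw [← Finset.sum_add_distrib, ← Finset.sum_add_distrib]
    refine Finset.sum_congr rfl fun i hi => ?_
    have : n + 1 - i = n - i + 1 := by have := Finset.mem_range.1 hi; omega
    rw [this, wEval_X_mul]
    ring
  rw [prevDeg_sum, Finset.sum_range_succ, key, Finset.sum_range_succ _ (n + 1), Nat.sub_self,
    wEval_zero_X_mul]
  ring

/-- The identity, for each single `i`, behind the recurrence of `solCoeff` in `n`. With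
`(w; q)_(i+1) = (w; q)_i (1 - q^i w)`, both sides are combinations of the same two values of
`wEval`, and `qBinom_absorb` compares the coefficients. -/
theorem wEval_step (n k i m : ℕ) :
    X ^ (i + 1 + m) * qBinom (i + m) m * wEval n k (X ^ (i + 1 + m) * qPoch (i + 1))
      + X ^ i * qBinom (i + m) m * (wEval n k (X ^ 2 * (X ^ (i + m) * qPoch i))
          - wEval n k (X * (X ^ (i + m) * qPoch i)))
    = (1 - X ^ (m + 1)) *
      (X ^ i * qBinom (i + (m + 1)) (m + 1) * wEval n k (X * (X ^ (i + (m + 1)) * qPoch i))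
        - X ^ i * qBinom (i + m) m * wEval n k (X * (X ^ (i + m) * qPoch i))) := by
  have h1 : (X ^ (i + 1 + m) * qPoch (i + 1) : ℤ[X][X])
      = X * (X ^ (i + m) * qPoch i) - C (X ^ i) * (X ^ 2 * (X ^ (i + m) * qPoch i)) := by
    rw [qPoch_succ]; ring
  have h2 : (X * (X ^ (i + (m + 1)) * qPoch i) : ℤ[X][X])
      = X ^ 2 * (X ^ (i + m) * qPoch i) := by ring
  rw [h1, h2, map_sub, wEval_C_mul]
  have h3 := qBinom_absorb i m
  generalize wEval n k (X ^ 2 * (X ^ (i + m) * qPoch i)) = P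
  generalize wEval n k (X * (X ^ (i + m) * qPoch i)) = Q
  linear_combination (-X ^ i * P) * h3

/-- The case `m = 0` of `solCoeff_rec_succ`, with the term for `m - 1` absent. -/
theorem solCoeff_rec_zero (n k : ℕ) :
    solCoeff (n + 1) k 0 = (1 - X) * (solCoeff n k 1 - solCoeff n k 0)
      + prevDeg (fun l => solCoeff n l 0) k := by
  rw [solCoeff_succ, add_left_inj, Finset.sum_range_succ']
  have h0 : wEval (n + 1) k 1 = 0 := by
    rw [← pow_zero X, wEval_X_pow, wCoeff_succ_zero_left, C_0]
  have h1 : (X ^ (0 + 0) * qPoch 0 : ℤ[X][X]) = 1 := by simp [qPoch]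
  rw [h1, Nat.sub_zero, h0, mul_zero, add_zero, ← Finset.sum_add_distrib, solCoeff, solCoeff,
    ← Finset.sum_sub_distrib, Finset.mul_sum]
  refine Finset.sum_congr rfl fun i _ => ?_
  have := wEval_step (n - i) k i 0
  rw [zero_add, pow_one] at this
  rw [← this, Nat.add_sub_add_right, qBinom_zero_right, qBinom_zero_right]

/-- The functional equation `z (1 - z) h = z + t ((1 - z) h(z) - (1 - q z) h(q z) + a z h(z))`, at the
coefficient of `tⁿ⁺¹ aᵏ zᵐ⁺²`, for the series `h` with the coefficients `solCoeff`. -/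
theorem solCoeff_rec_succ (n k m : ℕ) :
    solCoeff (n + 1) k (m + 1) - solCoeff (n + 1) k m
      = (1 - X ^ (m + 2)) * (solCoeff n k (m + 2) - solCoeff n k (m + 1))
      + prevDeg (fun l => solCoeff n l (m + 1)) k := by
  have hdef : solCoeff (n + 1) k m = ∑ i ∈ Finset.range (n + 2),
      X ^ i * qBinom (i + m) m * wEval (n + 1 - i) k (X * (X ^ (i + m) * qPoch i)) := rfl
  rw [solCoeff_succ, add_sub_right_comm, add_left_inj, add_sub_right_comm, hdef,
    ← Finset.sum_sub_distrib, Finset.sum_range_succ']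
  have h0 : (X ^ (0 + (m + 1)) * qPoch 0 : ℤ[X][X]) = X * (X ^ (0 + m) * qPoch 0) := by ring
  rw [h0, zero_add, zero_add, qBinom_self, qBinom_self, sub_self, add_zero,
    ← Finset.sum_add_distrib, solCoeff, solCoeff, ← Finset.sum_sub_distrib, Finset.mul_sum]
  refine Finset.sum_congr rfl fun i _ => ?_
  rw [← wEval_step (n - i) k i (m + 1), add_left_inj, Nat.add_sub_add_right, qBinom_pascal]
  have h1 : (X * (X ^ (i + 1 + m) * qPoch (i + 1)) : ℤ[X][X])
      = X ^ (i + 1 + (m + 1)) * qPoch (i + 1) := by ring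
  rw [h1]
  ring

/-- Expanding `(w; q)_i` turns the constant coefficient in `z` into the double sum. The terms with
`n - k < i ≤ n` vanish, since `wCoeff N r k = 0` for `N < k`. -/
theorem solCoeff_eq_sum {n k : ℕ} (hk : k ≤ n) :
    solCoeff n k 0 = ∑ j ∈ Finset.Icc 0 (n - k), ∑ i ∈ Finset.Icc j (n - k),
        (-1 : ℤ[X]) ^ j * C (B (n + 1) (k + 1) i j) *
          X ^ (i + j.choose 2) * qBinom i j := by
  have hterm : ∀ i ≤ n, X ^ i * qBinom (i + 0) 0 * wEval (n - i) k (X * (X ^ (i + 0) * qPoch i))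
      = ∑ j ∈ Finset.Icc 0 i, (-1 : ℤ[X]) ^ j * C (B (n + 1) (k + 1) i j) *
          X ^ (i + j.choose 2) * qBinom i j := by
    intro i hi
    have hdeg : (qPoch i).natDegree < i + 1 := by
      rw [Nat.lt_succ_iff, natDegree_le_iff_coeff_eq_zero]
      intro j hj
      rw [coeff_qPoch, qBinom_eq_zero hj, mul_zero]
    rw [qBinom_zero_right, add_zero]
    conv_lhs => rw [(qPoch i).as_sum_range_C_mul_X_pow' hdeg]
    rw [Finset.mul_sum, Finset.mul_sum, map_sum, Finset.mul_sum, Nat.range_succ_eq_Icc_zero]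
    refine Finset.sum_congr rfl fun j _ => ?_
    have : (X * (X ^ i * (C ((qPoch i).coeff j) * X ^ j)) : ℤ[X][X])
        = C ((qPoch i).coeff j) * X ^ (i + j + 1) := by ring
    rw [this, wEval_C_mul, wEval_X_pow, coeff_qPoch, B_eq_wCoeff j k hi]
    ring
  rw [solCoeff, Finset.sum_congr rfl fun i hi => hterm i (by
    have := Finset.mem_range.1 hi; omega)]
  rw [← Finset.sum_subset (s₁ := Finset.Icc 0 (n - k))]
  · refine Finset.sum_comm' fun i j => ?_
    simp only [Finset.mem_Icc]
    omega
  · intro i hi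
    simp only [Finset.mem_Icc, Finset.mem_range] at hi ⊢
    omega
  · intro i hi hi'
    simp only [Finset.mem_Icc, Finset.mem_range] at hi hi'
    refine Finset.sum_eq_zero fun j _ => ?_
    rw [B_eq_wCoeff j k (by omega), wCoeff_eq_zero (by omega)]
    simp


/-! ### Products of geometric series -/

/-- The geometric series `1 / (1 - x z)` in the variable `z`. -/
noncomputable def geomSeries (x : ℤ[X]) : PowerSeries ℤ[X] := PowerSeries.mk fun m => x ^ m

theorem one_sub_mul_geomSeries (x : ℤ[X]) :
    (1 - PowerSeries.C x * PowerSeries.X) * geomSeries x = 1 := by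
  ext1 m
  rw [sub_mul, one_mul, mul_assoc, map_sub, PowerSeries.coeff_C_mul]
  cases m with
  | zero => simp [geomSeries]
  | succ m =>
    rw [PowerSeries.coeff_succ_X_mul, PowerSeries.coeff_one, if_neg (by omega)]
    simp [geomSeries, pow_succ']

theorem rescale_geomSeries (q x : ℤ[X]) :
    PowerSeries.rescale q (geomSeries x) = geomSeries (q * x) := by
  ext1 m
  simp [geomSeries, PowerSeries.coeff_rescale, mul_pow]

theorem rescale_C (q x : ℤ[X]) :
    PowerSeries.rescale q (PowerSeries.C x) = PowerSeries.C x := by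
  ext1 m
  rw [PowerSeries.coeff_rescale, PowerSeries.coeff_C]
  split_ifs with h
  · rw [h, pow_zero, one_mul]
  · rw [mul_zero]

theorem geomSeries_sub (q x : ℤ[X]) :
    geomSeries x - geomSeries (q * x)
      = PowerSeries.X * PowerSeries.C ((1 - q) * x) * (geomSeries x * geomSeries (q * x)) := by
  have h1 := one_sub_mul_geomSeries x
  have h2 := one_sub_mul_geomSeries (q * x)
  simp only [map_mul, map_sub, map_one] at h1 h2 ⊢
  linear_combination geomSeries (q * x) * h1 - geomSeries x * h2

/-- The `q`-difference of a product of geometric series, as a telescoping sum: the parameters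
`x i` are multiplied by `q` one after the other, starting with the last. -/
theorem prod_geomSeries_sub (q : ℤ[X]) (x : ℕ → ℤ[X]) (n : ℕ) :
    PowerSeries.X * PowerSeries.C (1 - q) * ∑ p ∈ Finset.range n, PowerSeries.C (x p) *
        ((∏ i ∈ Finset.range (p + 1), geomSeries (x i))
          * ∏ i ∈ Finset.Ico p n, geomSeries (q * x i))
      = ∏ i ∈ Finset.range n, geomSeries (x i) - ∏ i ∈ Finset.range n, geomSeries (q * x i) := by
  have key := Finset.sum_range_sub (fun p => (∏ i ∈ Finset.range p, geomSeries (x i))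
          * ∏ i ∈ Finset.Ico p n, geomSeries (q * x i)) n
  simp only [Finset.Ico_self, Finset.prod_empty, mul_one, Finset.range_zero, one_mul,
    ← Finset.range_eq_Ico] at key
  rw [← key, Finset.mul_sum]
  refine Finset.sum_congr rfl fun p hp => ?_
  rw [Finset.prod_range_succ, Finset.prod_eq_prod_Ico_succ_bot (Finset.mem_range.1 hp)]
  have h := geomSeries_sub q (x p)
  rw [map_mul] at h
  linear_combination -((∏ i ∈ Finset.range p, geomSeries (x i))
          * ∏ i ∈ Finset.Ico (p + 1) n, geomSeries (q * x i)) * h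

/-! ### Insertion of a smallest value into a permutation -/

variable {n : ℕ}

/-- The permutation obtained from `σ` by raising all values by one and inserting the new smallest
value at position `p`. -/
def insertMin (p : Fin (n + 1)) (σ : Equiv.Perm (Fin n)) : Equiv.Perm (Fin (n + 1)) :=
  (finSuccEquiv' p).trans (σ.optionCongr.trans (finSuccEquiv' 0).symm)

@[simp]
theorem insertMin_self (p : Fin (n + 1)) (σ : Equiv.Perm (Fin n)) : insertMin p σ p = 0 := by
  simp [insertMin]

@[simp]
theorem insertMin_succAbove (p : Fin (n + 1)) (σ : Equiv.Perm (Fin n)) (i : Fin n) :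
    insertMin p σ (p.succAbove i) = (σ i).succ := by
  simp [insertMin]

theorem insertMin_bijective (n : ℕ) :
    Function.Bijective fun x : Fin (n + 1) × Equiv.Perm (Fin n) => insertMin x.1 x.2 := by
  rw [Fintype.bijective_iff_injective_and_card]
  constructor
  · rintro ⟨p, σ⟩ ⟨p', σ'⟩ h
    dsimp only at h
    have hp : p = p' := by
      apply (insertMin p' σ').injective
      rw [insertMin_self, ← h, insertMin_self]
    subst hp
    have hσ : σ = σ' := by
      ext1 i
      have := congrArg (fun τ => τ (p.succAbove i)) h
      simpa using this
    rw [hσ]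
  · simp [Fintype.card_perm, Nat.factorial_succ]

theorem val_succAbove (p : Fin (n + 1)) (i : Fin n) :
    (p.succAbove i : ℕ) = if (i : ℕ) < p then (i : ℕ) else i + 1 := by
  simp only [Fin.succAbove, Fin.lt_def, Fin.val_castSucc]
  split_ifs <;> simp

theorem card_filter_succAbove (p : Fin (n + 1)) (P : Fin (n + 1) → Prop) [DecidablePred P] :
    (Finset.univ.filter P).card
      = (if P p then 1 else 0) + (Finset.univ.filter fun i => P (p.succAbove i)).card := by
  simp only [Finset.card_filter]
  exact Fin.sum_univ_succAbove _ p

open Classical in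
/-- The number of entries to the left of position `p` that are exceeded by some entry at position
`p` or later. This is the number of new special inversions when a smallest value is inserted at
position `p`. -/
noncomputable def cover (σ : Equiv.Perm (Fin n)) (p : ℕ) : ℕ :=
  (Finset.univ.filter fun i : Fin n => (i : ℕ) < p ∧ ∃ m : Fin n, p ≤ (m : ℕ) ∧ σ i < σ m).card

theorem cover_self (σ : Equiv.Perm (Fin n)) : cover σ n = 0 := by
  rw [cover, Finset.card_eq_zero, Finset.filter_eq_empty_iff]
  rintro i - ⟨-, m, hm, -⟩
  exact absurd m.isLt (by omega)

theorem cover_insertMin_of_le (p : Fin (n + 1)) (σ : Equiv.Perm (Fin n)) {j : ℕ}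
    (hj : j ≤ p) : cover (insertMin p σ) j = cover σ j := by
  classical
  rw [cover, card_filter_succAbove p, if_neg (by omega), zero_add, cover]
  congr 1
  ext i
  simp only [Finset.mem_filter, Finset.mem_univ, true_and, Fin.exists_iff_succAbove p,
    insertMin_self, insertMin_succAbove, Fin.succ_lt_succ_iff, Fin.not_lt_zero, and_false,
    false_or, val_succAbove]
  refine and_congr (by split_ifs <;> omega) (exists_congr fun m => and_congr_left fun _ => ?_)
  split_ifs <;> omega

theorem cover_insertMin_of_lt (p : Fin (n + 1)) (σ : Equiv.Perm (Fin n)) {j : ℕ}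
    (hj : p ≤ j) (hjn : j < n) : cover (insertMin p σ) (j + 1) = cover σ j + 1 := by
  classical
  -- the new smallest entry is itself exceeded by the last entry
  have hm : ∃ m : Fin (n + 1), j + 1 ≤ (m : ℕ) ∧ insertMin p σ p < insertMin p σ m := by
    refine ⟨Fin.last n, by simp; omega, ?_⟩
    rw [insertMin_self, Fin.pos_iff_ne_zero, ← insertMin_self p σ]
    refine (insertMin p σ).injective.ne fun h => ?_
    rw [← h, Fin.val_last] at hj
    omega
  rw [cover, card_filter_succAbove p, if_pos ⟨by omega, hm⟩, cover, add_comm]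
  congr 2
  ext i
  simp only [Finset.mem_filter, Finset.mem_univ, true_and, Fin.exists_iff_succAbove p,
    insertMin_self, insertMin_succAbove, Fin.succ_lt_succ_iff, Fin.not_lt_zero, and_false,
    false_or, val_succAbove]
  refine and_congr (by split_ifs <;> omega) (exists_congr fun m => and_congr_left fun _ => ?_)
  split_ifs <;> omega

theorem rlm_insertMin (p : Fin (n + 1)) (σ : Equiv.Perm (Fin n)) :
    rlm (insertMin p σ) = (if p = Fin.last n then 1 else 0) + rlm σ := by
  classical
  have h1 : IsRLMax (insertMin p σ) p ↔ p = Fin.last n := by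
    constructor
    · intro h
      by_contra hp
      have := h _ (Fin.lt_last_iff_ne_last.2 hp)
      simp at this
    · rintro rfl j hj
      exact absurd hj (Fin.le_last j).not_gt
  have h2 : ∀ i, IsRLMax (insertMin p σ) (p.succAbove i) ↔ IsRLMax σ i := fun i => by
    simp [IsRLMax, Fin.forall_iff_succAbove p]
  rw [rlm, card_filter_succAbove p, rlm]
  simp only [h1, h2]

theorem lt_succAbove_iff_val_le (p : Fin (n + 1)) (i : Fin n) :
    p < p.succAbove i ↔ (p : ℕ) ≤ i := by
  rw [Fin.lt_def, val_succAbove]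
  split_ifs <;> omega

theorem succAbove_lt_iff_val_lt (p : Fin (n + 1)) (i : Fin n) :
    p.succAbove i < p ↔ (i : ℕ) < p := by
  rw [Fin.lt_def, val_succAbove]
  split_ifs <;> omega

theorem specialInv_insertMin (p : Fin (n + 1)) (σ : Equiv.Perm (Fin n)) :
    specialInv (insertMin p σ) = specialInv σ + cover σ p := by
  classical
  have h0 : ∀ j, ¬ IsSpecialInv (insertMin p σ) p j := fun j h => by
    have := h.2.1
    simp at this
  have h1 : ∀ i, IsSpecialInv (insertMin p σ) (p.succAbove i) p
      ↔ (i : ℕ) < p ∧ ∃ m : Fin n, (p : ℕ) ≤ m ∧ σ i < σ m := fun i => by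
    simp [IsSpecialInv, Fin.exists_iff_succAbove p, lt_succAbove_iff_val_le,
      succAbove_lt_iff_val_lt]
  have h2 : ∀ i j, IsSpecialInv (insertMin p σ) (p.succAbove i) (p.succAbove j)
      ↔ IsSpecialInv σ i j := fun i j => by
    simp [IsSpecialInv, Fin.exists_iff_succAbove p]
  rw [specialInv, specialInv, cover]
  simp only [Finset.card_filter, Fintype.sum_prod_type, Fin.sum_univ_succAbove _ p, h0, h1, h2,
    if_false, Finset.sum_const_zero, zero_add, Finset.sum_add_distrib]
  exact add_comm _ _

/-- The series `∏ 1 / (1 - q^(c_p) z)` over the positions `p` of `σ`, where `c_p = cover σ p`. -/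
noncomputable def coverSeries (σ : Equiv.Perm (Fin n)) : PowerSeries ℤ[X] :=
  ∏ p ∈ Finset.range n, geomSeries (X ^ cover σ p)

/-- Inserting a smallest value at position `p` duplicates `c_p`, and raises by one the second copy
and all later `c_i`. -/
theorem coverSeries_insertMin (p : Fin (n + 1)) (σ : Equiv.Perm (Fin n)) :
    coverSeries (insertMin p σ) = (∏ i ∈ Finset.range (p + 1), geomSeries (X ^ cover σ i))
      * ∏ i ∈ Finset.Ico (p : ℕ) n, geomSeries (X * X ^ cover σ i) := by
  rw [coverSeries, ← Finset.prod_range_mul_prod_Ico _ (show (p : ℕ) + 1 ≤ n + 1 from p.isLt)]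
  congr 1
  · refine Finset.prod_congr rfl fun j hj => ?_
    rw [cover_insertMin_of_le p σ (Nat.lt_succ_iff.1 (Finset.mem_range.1 hj))]
  · rw [← Finset.prod_Ico_add']
    refine Finset.prod_congr rfl fun j hj => ?_
    have := Finset.mem_Ico.1 hj
    rw [cover_insertMin_of_lt p σ this.1 this.2, pow_succ']

theorem coverSeries_insertMin_last (σ : Equiv.Perm (Fin n)) :
    coverSeries (insertMin (Fin.last n) σ) = coverSeries σ * geomSeries 1 := by
  rw [coverSeries_insertMin, Fin.val_last, Finset.Ico_self, Finset.prod_empty, mul_one,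
    Finset.prod_range_succ, cover_self, pow_zero, coverSeries]

/-! ### The `q`-difference equation for permutations -/

/-- The refinement of `qStirling₁ n k`, its constant coefficient, in which each permutation is
weighted by its `coverSeries`. -/
noncomputable def stirlingSeries (n k : ℕ) : PowerSeries ℤ[X] :=
  ∑ σ : Equiv.Perm (Fin n),
    if rlm σ = k then PowerSeries.C (X ^ specialInv σ) * coverSeries σ else 0

theorem coeff_zero_stirlingSeries (n k : ℕ) :
    PowerSeries.coeff 0 (stirlingSeries n k) = qStirling₁ n k := by
  rw [stirlingSeries, qStirling₁, Finset.sum_filter, map_sum]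
  refine Finset.sum_congr rfl fun σ _ => ?_
  split_ifs
  · simp [coverSeries, geomSeries, map_prod]
  · simp

theorem sum_insertMin_castSucc (σ : Equiv.Perm (Fin n)) :
    PowerSeries.X * PowerSeries.C (1 - X) * ∑ p : Fin n,
        PowerSeries.C (X ^ specialInv (insertMin p.castSucc σ))
          * coverSeries (insertMin p.castSucc σ)
      = PowerSeries.C (X ^ specialInv σ) *
        (coverSeries σ - PowerSeries.rescale X (coverSeries σ)) := by
  have h : coverSeries σ - PowerSeries.rescale X (coverSeries σ)
      = PowerSeries.X * PowerSeries.C (1 - X) * ∑ p : Fin n, PowerSeries.C (X ^ cover σ p) *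
        coverSeries (insertMin p.castSucc σ) := by
    simp only [coverSeries_insertMin, Fin.val_castSucc]
    rw [Fin.sum_univ_eq_sum_range fun p => PowerSeries.C (X ^ cover σ p) *
        ((∏ i ∈ Finset.range (p + 1), geomSeries (X ^ cover σ i))
          * ∏ i ∈ Finset.Ico p n, geomSeries (X * X ^ cover σ i)),
      prod_geomSeries_sub X (fun i => X ^ cover σ i) n, coverSeries, map_prod]
    simp only [rescale_geomSeries]
  have h' : ∀ p : Fin n, PowerSeries.C (X ^ specialInv (insertMin p.castSucc σ))
      = PowerSeries.C (X ^ specialInv σ) * PowerSeries.C (X ^ cover σ p : ℤ[X]) := fun p => by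
    rw [specialInv_insertMin, Fin.val_castSucc, pow_add, map_mul]
  simp only [h', mul_assoc, ← Finset.mul_sum, h]
  ring

/-- A smallest value inserted before the last position acts by the `q`-derivative, and one inserted
at the last position, which is a new right-to-left maximum, by multiplication with
`1 / (1 - z)`. -/
theorem stirlingSeries_succ (n k : ℕ) :
    PowerSeries.X * PowerSeries.C (1 - X) * stirlingSeries (n + 1) k
      = stirlingSeries n k - PowerSeries.rescale X (stirlingSeries n k)
        + PowerSeries.X * PowerSeries.C (1 - X) *
          (prevDeg (stirlingSeries n) k * geomSeries 1) := by
  rw [stirlingSeries, ← (insertMin_bijective n).sum_comp, Fintype.sum_prod_type,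
    Fin.sum_univ_castSucc, mul_add]
  congr 1
  · rw [Finset.sum_comm, Finset.mul_sum, stirlingSeries, map_sum, ← Finset.sum_sub_distrib]
    refine Finset.sum_congr rfl fun σ _ => ?_
    simp only [rlm_insertMin, Fin.castSucc_ne_last, if_false, zero_add]
    split_ifs
    · rw [sum_insertMin_castSucc, map_mul, rescale_C, mul_sub]
    · simp
  · congr 1
    simp only [rlm_insertMin, if_true, specialInv_insertMin, Fin.val_last, cover_self, add_zero,
      coverSeries_insertMin_last]
    cases k with
    | zero => simp [prevDeg]
    | succ k =>
      rw [prevDeg, stirlingSeries, Finset.sum_mul]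
      refine Finset.sum_congr rfl fun σ _ => ?_
      simp only [add_comm 1, add_left_inj, ite_mul, zero_mul, mul_assoc]

/-! ### Comparison of the two solutions -/

/-- The series `(1 - z) ∑ solCoeff n k m zᵐ`. -/
noncomputable def solSeries (n k : ℕ) : PowerSeries ℤ[X] :=
  (1 - PowerSeries.X) * PowerSeries.mk (solCoeff n k)

theorem coeff_zero_solSeries (n k : ℕ) :
    PowerSeries.coeff 0 (solSeries n k) = solCoeff n k 0 := by
  simp [solSeries]

theorem coeff_succ_solSeries (n k m : ℕ) :
    PowerSeries.coeff (m + 1) (solSeries n k) = solCoeff n k (m + 1) - solCoeff n k m := by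
  rw [solSeries, sub_mul, one_mul, map_sub, PowerSeries.coeff_succ_X_mul]
  simp

theorem one_sub_X_mul_geomSeries_one : (1 - PowerSeries.X) * geomSeries 1 = 1 := by
  simpa using one_sub_mul_geomSeries 1

theorem prevDeg_solSeries_mul (n k : ℕ) :
    prevDeg (solSeries n) k * geomSeries 1
      = PowerSeries.mk fun m => prevDeg (fun l => solCoeff n l m) k := by
  cases k with
  | zero => ext1 m; simp [prevDeg]
  | succ k =>
    simp only [prevDeg]
    rw [solSeries, mul_right_comm, one_sub_X_mul_geomSeries_one, one_mul]

theorem solSeries_succ (n k : ℕ) :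
    PowerSeries.X * solSeries (n + 1) k
      = solSeries n k - PowerSeries.rescale X (solSeries n k)
        + PowerSeries.X * (prevDeg (solSeries n) k * geomSeries 1) := by
  rw [prevDeg_solSeries_mul]
  ext1 m
  rw [map_add, map_sub, PowerSeries.coeff_rescale]
  cases m with
  | zero => simp
  | succ m =>
    rw [PowerSeries.coeff_succ_X_mul, PowerSeries.coeff_succ_X_mul, coeff_succ_solSeries,
      PowerSeries.coeff_mk]
    cases m with
    | zero => rw [coeff_zero_solSeries, solCoeff_rec_zero]; ring
    | succ m => rw [coeff_succ_solSeries, solCoeff_rec_succ]; ring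

/-- Both sides satisfy the same recurrence in `n`, namely `stirlingSeries_succ` multiplied by
`(1 - q)ⁿ` and `solSeries_succ` multiplied by `(1 - q)ᵏ`. -/
theorem one_sub_X_pow_mul_stirlingSeries (n k : ℕ) :
    PowerSeries.C (1 - X) ^ n * stirlingSeries n k = PowerSeries.C (1 - X) ^ k * solSeries n k := by
  induction n generalizing k with
  | zero =>
    have h : rlm (Equiv.refl (Fin 0)) = 0 := by simp [rlm]
    have h' : specialInv (Equiv.refl (Fin 0)) = 0 := by simp [specialInv]
    have hs : solSeries 0 k = if k = 0 then 1 else 0 := by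
      have : PowerSeries.mk (solCoeff 0 k) = if k = 0 then geomSeries 1 else 0 := by
        ext1 m
        rw [PowerSeries.coeff_mk, solCoeff_zero]
        split_ifs <;> simp [geomSeries]
      rw [solSeries, this, mul_ite, one_sub_X_mul_geomSeries_one, mul_zero]
    rw [hs, stirlingSeries, Fintype.sum_unique]
    by_cases hk : k = 0
    · subst hk
      have e : (default : Equiv.Perm (Fin 0)) = Equiv.refl _ := rfl
      rw [e, h, h']
      simp [coverSeries]
    · have e : (default : Equiv.Perm (Fin 0)) = Equiv.refl _ := rfl
      rw [e, h, if_neg (Ne.symm hk), if_neg hk]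
      simp
  | succ n ih =>
    have hX : (PowerSeries.X : PowerSeries ℤ[X]) ≠ 0 := PowerSeries.X_ne_zero
    apply mul_left_cancel₀ hX
    have hS := stirlingSeries_succ n k
    have hT := solSeries_succ n k
    have hr := congrArg (PowerSeries.rescale (X : ℤ[X])) (ih k)
    simp only [map_mul, map_pow, rescale_C] at hr
    have hp : PowerSeries.C (1 - X) ^ (n + 1) * prevDeg (stirlingSeries n) k
        = PowerSeries.C (1 - X) ^ k * prevDeg (solSeries n) k := by
      cases k with
      | zero => simp [prevDeg]
      | succ k => rw [prevDeg, prevDeg, pow_succ', pow_succ', mul_assoc, ih k, mul_assoc]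
    linear_combination PowerSeries.C (1 - X) ^ n * hS - PowerSeries.C (1 - X) ^ k * hT + ih k - hr
      + PowerSeries.X * geomSeries 1 * hp

theorem one_sub_X_pow_mul_qStirling₁ (n k : ℕ) :
    (1 - X : ℤ[X]) ^ n * qStirling₁ n k = (1 - X) ^ k * solCoeff n k 0 := by
  have h := congrArg (PowerSeries.coeff 0) (one_sub_X_pow_mul_stirlingSeries n k)
  rwa [← map_pow, ← map_pow, PowerSeries.coeff_C_mul, PowerSeries.coeff_C_mul,
    coeff_zero_stirlingSeries, coeff_zero_solSeries] at h

end QStirling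

theorem mainTheorem4 (n k : ℕ) (hk : k ≤ n) :
    (1 - X : ℤ[X]) ^ (n - k) * QStirling.qStirling₁ n k =
      ∑ j ∈ Finset.Icc 0 (n - k), ∑ i ∈ Finset.Icc j (n - k),
        (-1 : ℤ[X]) ^ j * C (QStirling.B (n + 1) (k + 1) i j) *
          X ^ (i + j.choose 2) * QStirling.qBinom i j := by
  have hne : (1 - X : ℤ[X]) ^ k ≠ 0 := pow_ne_zero _ (sub_ne_zero.2 (X_ne_C 1).symm)
  apply mul_left_cancel₀ hne
  rw [← QStirling.solCoeff_eq_sum hk, ← mul_assoc, ← pow_add, Nat.add_sub_cancel' hk,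
    QStirling.one_sub_X_pow_mul_qStirling₁]
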